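/- Let $d\in\mathbb N$, $\kappa>0$, $\sigma>0$ and $\alpha\in\mathbb R$ (in particular, any non-integer $\alpha>d/2$). Let $W$ be spectrally truncated white noise on $\mathbb R^d$, i.e. a generalised random field $\varphi\mapsto W(\varphi)$, indexed by the real Schwartz functions $\varphi$ on $\mathbb R^d$, which is a centred Gaussian family with $$\mathbb E[W(\varphi)W(\psi)]=\int\!\!\int \varphi(x)\psi(y)\,C_W(x,y)\,dx\,dy,\qquad C_W(x,y)=\frac{\sigma^2}{(2\pi)^d}\int_{|\xi|\le\kappa}e^{-i(x-y)\cdot\xi}\,d\xi .$$ Let $X$ be the weak solution of $$(-\Delta+\kappa^2)^{\alpha/2}X=W,$$ i.e. a generalised random field with $X\big((-\Delta+\kappa^2)^{\alpha/2}\varphi\big)=W(\varphi)$ almost surely for every real Schwartz function $\varphi$, where $(-\Delta+\kappa^2)^{\alpha/2}$ is the Fourier multiplier with symbol $(\kappa^2+|\xi|^2)^{\alpha/2}$. Then the sample paths of $X$ are $C^\infty$ on $\mathbb R^d$ with probability $1$, in the following sense. There is a random field $(Y(x))_{x\in\mathbb R^d}$ of real random variables such that, almost surely, $x\mapsto Y(x)$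 is $C^\infty$ on $\mathbb R^d$ and $\varphi Y$ is integrable for all real Schwartz functions $\varphi$, and such that for every real Schwartz function $\varphi$ $$X(\varphi)=\int_{\mathbb R^d}\varphi(x)\,Y(x)\,dx\quad\text{almost surely.}$$ If moreover the realisations of $X$ are almost surely tempered distributions, then almost surely this identity holds for all real Schwartz functions $\varphi$ simultaneously, i.e. almost every realisation of $X$ is a $C^\infty$ function. -/

import Mathlib

open MeasureTheory ProbabilityTheory
open scoped SchwartzMap

namespace BandLimitedMatern

/-- `ℝ^d` with its Euclidean norm and Lebesgue measure. -/
abbrev E (d : ℕ) : Type := EuclideanSpace ℝ (Fin d)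

/-! ### Fractional powers of `-Δ + κ²` acting on real test functions -/

/-- Post-composition of a Schwartz function with a continuous real-linear map. -/
noncomputable def postcomp {d : ℕ} {F G : Type*} [NormedAddCommGroup F] [NormedSpace ℝ F]
    [NormedAddCommGroup G] [NormedSpace ℝ G] (T : F →L[ℝ] G) (f : 𝓢(E d, F)) : 𝓢(E d, G) where
  toFun := fun x => T (f x)
  smooth' := T.contDiff.comp (f.smooth ⊤)
  decay' := by
    intro k n
    obtain ⟨C, hC⟩ := f.decay' k n
    refine ⟨‖T‖ * C, fun x => ?_⟩
    have h := T.norm_iteratedFDeriv_comp_left (f := f) (x := x) (n := n)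
      ((f.smooth ⊤).contDiffAt) (by exact_mod_cast le_top)
    calc ‖x‖ ^ k * ‖iteratedFDeriv ℝ n (fun x => T (f x)) x‖
        ≤ ‖x‖ ^ k * (‖T‖ * ‖iteratedFDeriv ℝ n f x‖) := by gcongr; exact h
      _ = ‖T‖ * (‖x‖ ^ k * ‖iteratedFDeriv ℝ n f x‖) := by ring
      _ ≤ ‖T‖ * C := by gcongr; exact hC x

/-- A real Schwartz function regarded as a complex-valued one. -/
noncomputable def complexify {d : ℕ} (φ : 𝓢(E d, ℝ)) : 𝓢(E d, ℂ) :=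
  postcomp Complex.ofRealCLM φ

/-- The real part of a complex Schwartz function. -/
noncomputable def realPart {d : ℕ} (f : 𝓢(E d, ℂ)) : 𝓢(E d, ℝ) :=
  postcomp Complex.reCLM f

/-- The symbol `(κ² + |2πξ|²)^{α/2}` of `(-Δ + κ²)^{α/2}`.  The factor `2π` is there because
Mathlib's Fourier transform has the kernel `exp (-2πi x·ξ)`. -/
noncomputable def symbol (d : ℕ) (κ α : ℝ) (ξ : E d) : ℝ :=
  (κ ^ 2 + (2 * Real.pi * ‖ξ‖) ^ 2) ^ (α / 2)

/-- The symbol is an admissible Fourier multiplier, so that the definition below is not a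
default value. -/
theorem symbol_hasTemperateGrowth (d : ℕ) {κ : ℝ} (hκ : 0 < κ) (α : ℝ) :
    (symbol d κ α).HasTemperateGrowth := by
  have h1 := (Function.hasTemperateGrowth_one_add_norm_sq_rpow (E d) (α / 2)).comp
    (((2 * Real.pi / κ) • ContinuousLinearMap.id ℝ (E d)).hasTemperateGrowth)
  have h2 := (Function.HasTemperateGrowth.const (E := E d) ((κ ^ 2) ^ (α / 2))).mul h1
  convert! h2 using 1
  ext ξ
  have : κ ^ 2 + (2 * Real.pi * ‖ξ‖) ^ 2
      = κ ^ 2 * (1 + ‖(2 * Real.pi / κ) • ξ‖ ^ 2) := by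
    rw [norm_smul, Real.norm_of_nonneg (by positivity)]
    field_simp
  simp only [symbol, Pi.mul_apply, Function.comp_apply, smul_apply,
    ContinuousLinearMap.id_apply]
  rw [this, Real.mul_rpow (by positivity) (by positivity)]

/-- The operator `(-Δ + κ²)^{α/2}` on complex Schwartz functions, as a Fourier multiplier. -/
noncomputable def fracOpComplex {d : ℕ} (κ α : ℝ) (f : 𝓢(E d, ℂ)) : 𝓢(E d, ℂ) :=
  SchwartzMap.fourierMultiplierCLM ℂ (symbol d κ α) f

/-- The operator `(-Δ + κ²)^{α/2}` on real test functions.  (The multiplier is real and even, so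
it maps real functions to real functions and taking the real part loses nothing, see
`complexify_fracOp`.) -/
noncomputable def fracOp {d : ℕ} (κ α : ℝ) (φ : 𝓢(E d, ℝ)) : 𝓢(E d, ℝ) :=
  realPart (fracOpComplex κ α (complexify φ))

theorem complexify_fracOp {d : ℕ} {κ : ℝ} (hκ : 0 < κ) (α : ℝ) (φ : 𝓢(E d, ℝ)) :
    complexify (fracOp κ α φ) = fracOpComplex κ α (complexify φ) := by
  have hF : ∀ ξ : E d, (starRingEnd ℂ) (FourierTransform.fourier (complexify φ) ξ)
      = FourierTransform.fourier (complexify φ) (-ξ) := by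
    intro ξ
    rw [SchwartzMap.fourier_coe, Real.fourier_eq', Real.fourier_eq', ← integral_conj]
    congr 1
    ext v
    have : (complexify φ) v = ((φ v : ℝ) : ℂ) := rfl
    simp [this, ← Complex.exp_conj, Complex.conj_ofNat]
  have hreal : ∀ x : E d, (starRingEnd ℂ) (fracOpComplex κ α (complexify φ) x)
      = fracOpComplex κ α (complexify φ) x := by
    intro x
    rw [fracOpComplex, SchwartzMap.fourierMultiplierCLM_apply, SchwartzMap.fourierInv_coe,
      Real.fourierInv_eq', ← integral_conj, ← integral_neg_eq_self]
    congr 1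
    ext ξ
    rw [SchwartzMap.smulLeftCLM_apply_apply (symbol_hasTemperateGrowth d hκ α),
      SchwartzMap.smulLeftCLM_apply_apply (symbol_hasTemperateGrowth d hκ α)]
    simp [← Complex.exp_conj, hF, symbol, Complex.conj_ofNat]
  ext x
  exact Complex.conj_eq_iff_re.mp (hreal x)

/-! ### The spectrally truncated noise and the equation -/

/-- The covariance function
`C_W(x,y) = σ² (2π)^{-d} ∫_{|ξ| ≤ κ} exp (-i (x-y)·ξ) dξ`. -/
noncomputable def covW {d : ℕ} (σ κ : ℝ) (x y : E d) : ℂ :=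
  ((σ ^ 2 / (2 * Real.pi) ^ d : ℝ) : ℂ) *
    ∫ ξ in Metric.closedBall (0 : E d) κ, Complex.exp (-Complex.I * ((inner ℝ (x - y) ξ : ℝ) : ℂ))

/-- A generalised random field is given by its values `W φ` on real test functions `φ`.
`W` is spectrally truncated white noise if it is a centred Gaussian family with
`E[W(φ) W(ψ)] = ∫∫ φ(x) ψ(y) C_W(x,y) dx dy`.  (Linearity of `φ ↦ W φ` almost surely is a
consequence.) -/
structure IsTruncatedWhiteNoise {Ω : Type*} [MeasurableSpace Ω] {d : ℕ}
    (σ κ : ℝ) (W : 𝓢(E d, ℝ) → Ω → ℝ) (P : Measure Ω) : Prop where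
  gaussian : IsGaussianProcess W P
  mean : ∀ φ, ∫ ω, W φ ω ∂P = 0
  covariance : ∀ φ ψ, ((∫ ω, W φ ω * W ψ ω ∂P : ℝ) : ℂ) =
    ∫ x, ∫ y, ((φ x * ψ y : ℝ) : ℂ) * covW σ κ x y

/-- `X` is a weak solution of `(-Δ + κ²)^{α/2} X = W`: for every test function `φ`,
`⟨X, (-Δ + κ²)^{α/2} φ⟩ = ⟨W, φ⟩` almost surely. -/
def IsWeakSolution {Ω : Type*} [MeasurableSpace Ω] {d : ℕ} (κ α : ℝ)
    (X W : 𝓢(E d, ℝ) → Ω → ℝ) (P : Measure Ω) : Prop :=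
  ∀ φ, ∀ᵐ ω ∂P, X (fracOp κ α φ) ω = W φ ω

end BandLimitedMatern

open MeasureTheory ProbabilityTheory
open scoped SchwartzMap

namespace BandLimitedMatern

open FourierTransform LineDeriv Filter Topology

/-! The noise lives on the bounded frequency set `|ξ| ≤ κ`: by `integral_covW`, `E[W(φ)W(ψ)]` is a
multiple of the `L²` pairing of `ft φ` and `ft ψ` over the band. Hence `W` is a linear map into
`L²(P)` that sees only `ft φ` on the band. There the symbol of the operator is bounded above and
below, whatever the sign of `α`.

Choose `η` with `ft η = 1` on the band and put `ψ = (-Δ+κ²)^{-α/2} η`. The smooth field is `Y(x) =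
W(ψ(· - x))`. Each derivative costs at most a factor `κ` in `L²` (`IsModel.norm_partialDeriv_le`),
so the random Taylor series of `Y` at `0` almost surely converges on all of `ℝ^d`, and its sum is
smooth (`IsModel.exists_smooth_field`).

Averaging `Y` against `φ` gives `W(φ * ψ)`, and `φ * ψ` agrees on the band with `(-Δ+κ²)^{-α/2} φ`;
the weak equation identifies the result with `X(φ)`. When the realisations of `X` are tempered,
separability of the Schwartz space puts all `φ` outside a single null set. -/

/-! ### Fourier transform of real test functions -/

/-- The Fourier transform `∫ φ(x) exp (-i x·ξ) dx` of a real test function. -/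
noncomputable def ft {d : ℕ} (φ : 𝓢(E d, ℝ)) (ξ : E d) : ℂ :=
  ∫ x, (φ x : ℂ) * Complex.exp (-Complex.I * ((inner ℝ x ξ : ℝ) : ℂ))

/-- The spectral band `|ξ| ≤ κ`. -/
abbrev band (d : ℕ) (κ : ℝ) : Set (E d) := Metric.closedBall 0 κ

theorem norm_exp_neg_I_mul (t : ℝ) : ‖Complex.exp (-Complex.I * (t : ℂ))‖ = 1 := by
  rw [show -Complex.I * (t : ℂ) = ((-t : ℝ) : ℂ) * Complex.I by push_cast; ring]
  exact Complex.norm_exp_ofReal_mul_I _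

theorem conj_exp_neg_I_mul (t : ℝ) : (starRingEnd ℂ) (Complex.exp (-Complex.I * (t : ℂ)))
    = Complex.exp (-Complex.I * ((-t : ℝ) : ℂ)) := by
  rw [← Complex.exp_conj]
  simp

theorem complexify_apply {d : ℕ} (φ : 𝓢(E d, ℝ)) (x : E d) : complexify φ x = (φ x : ℂ) := rfl

theorem ft_eq_fourier {d : ℕ} (φ : 𝓢(E d, ℝ)) (ξ : E d) :
    ft φ ξ = 𝓕 (complexify φ) ((2 * Real.pi)⁻¹ • ξ) := by
  rw [SchwartzMap.fourier_coe, Real.fourier_eq', ft]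
  congr 1
  ext x
  rw [complexify_apply, smul_eq_mul, mul_comm, inner_smul_right]
  congr 2
  push_cast
  field_simp

theorem continuous_ft {d : ℕ} (φ : 𝓢(E d, ℝ)) : Continuous (ft φ) := by
  have : ft φ = fun ξ => 𝓕 (complexify φ) ((2 * Real.pi)⁻¹ • ξ) := funext (ft_eq_fourier φ)
  rw [this]
  exact (𝓕 (complexify φ)).continuous.comp (by fun_prop)

theorem complexify_add {d : ℕ} (φ ψ : 𝓢(E d, ℝ)) :
    complexify (φ + ψ) = complexify φ + complexify ψ := by
  ext x; simp [complexify_apply]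

theorem complexify_smul {d : ℕ} (a : ℝ) (φ : 𝓢(E d, ℝ)) :
    complexify (a • φ) = (a : ℂ) • complexify φ := by
  ext x; simp [complexify_apply]

theorem ft_add {d : ℕ} (φ ψ : 𝓢(E d, ℝ)) (ξ : E d) : ft (φ + ψ) ξ = ft φ ξ + ft ψ ξ := by
  simp [ft_eq_fourier, complexify_add, FourierAdd.fourier_add]

theorem ft_smul {d : ℕ} (a : ℝ) (φ : 𝓢(E d, ℝ)) (ξ : E d) : ft (a • φ) ξ = a * ft φ ξ := by
  simp [ft_eq_fourier, complexify_smul, FourierSMul.fourier_smul]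

/-- `ft` as a linear map. -/
noncomputable def ftLM (d : ℕ) : 𝓢(E d, ℝ) →ₗ[ℝ] (E d → ℂ) where
  toFun := ft
  map_add' φ ψ := funext (ft_add φ ψ)
  map_smul' a φ := funext fun ξ => by simp [ft_smul]

theorem ftLM_apply {d : ℕ} (φ : 𝓢(E d, ℝ)) : ftLM d φ = ft φ := rfl

theorem ft_neg {d : ℕ} (φ : 𝓢(E d, ℝ)) (ξ : E d) : ft φ (-ξ) = (starRingEnd ℂ) (ft φ ξ) := by
  rw [ft, ft, ← integral_conj]
  congr 1
  ext x
  rw [map_mul, conj_exp_neg_I_mul]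
  simp

theorem ft_translate {d : ℕ} (φ : 𝓢(E d, ℝ)) (a ξ : E d) :
    ft (φ.compSubConstCLM ℝ a) ξ
      = Complex.exp (-Complex.I * ((inner ℝ a ξ : ℝ) : ℂ)) * ft φ ξ := by
  rw [ft, ft, ← integral_add_right_eq_self _ a, ← integral_const_mul]
  congr 1
  ext x
  rw [SchwartzMap.compSubConstCLM_apply, add_sub_cancel_right, inner_add_left, Complex.ofReal_add,
    mul_add, Complex.exp_add]
  ring

theorem complexify_lineDeriv {d : ℕ} (φ : 𝓢(E d, ℝ)) (v : E d) :
    complexify (∂_{v} φ) = ∂_{v} (complexify φ) := by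
  ext x
  rw [complexify_apply, SchwartzMap.lineDerivOp_apply_eq_fderiv,
    SchwartzMap.lineDerivOp_apply_eq_fderiv]
  have h : HasFDerivAt (complexify φ) (Complex.ofRealCLM.comp (fderiv ℝ φ x)) x :=
    Complex.ofRealCLM.hasFDerivAt.comp x φ.differentiableAt.hasFDerivAt
  rw [h.fderiv]
  rfl

theorem ft_lineDeriv {d : ℕ} (φ : 𝓢(E d, ℝ)) (v ξ : E d) :
    ft (∂_{v} φ) ξ = Complex.I * ((inner ℝ v ξ : ℝ) : ℂ) * ft φ ξ := by
  rw [ft_eq_fourier, ft_eq_fourier, complexify_lineDeriv, SchwartzMap.fourier_lineDerivOp_eq]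
  have : (inner ℝ · v : E d → ℝ).HasTemperateGrowth := by fun_prop
  rw [smul_apply, SchwartzMap.smulLeftCLM_apply_apply this, inner_smul_left, real_inner_comm]
  have hπ : (Real.pi : ℂ) ≠ 0 := by exact_mod_cast Real.pi_ne_zero
  simp only [smul_eq_mul, Complex.real_smul, conj_trivial]
  push_cast
  field_simp

theorem ft_iteratedLineDeriv {d : ℕ} (φ : 𝓢(E d, ℝ)) {n : ℕ} (v : Fin n → E d) (ξ : E d) :
    ft (∂^{v} φ) ξ = (∏ i, Complex.I * ((inner ℝ (v i) ξ : ℝ) : ℂ)) * ft φ ξ := by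
  induction n with
  | zero => simp
  | succ n ih =>
    rw [iteratedLineDerivOp_succ_left, ft_lineDeriv, ih, Fin.prod_univ_succ, ← mul_assoc]
    rfl

theorem ft_fracOp {d : ℕ} {κ : ℝ} (hκ : 0 < κ) (β : ℝ) (φ : 𝓢(E d, ℝ)) (ξ : E d) :
    ft (fracOp κ β φ) ξ = (((κ ^ 2 + ‖ξ‖ ^ 2) ^ (β / 2) : ℝ) : ℂ) * ft φ ξ := by
  rw [ft_eq_fourier, ft_eq_fourier, complexify_fracOp hκ, fracOpComplex,
    SchwartzMap.fourierMultiplierCLM_apply, FourierInvPair.fourier_fourierInv_eq,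
    SchwartzMap.smulLeftCLM_apply_apply (symbol_hasTemperateGrowth d hκ β), symbol, norm_smul,
    Complex.real_smul, Real.norm_of_nonneg (by positivity), mul_inv_cancel_left₀ (by positivity)]

/-- Lets the weak equation be solved for `X φ`: every test function is in the range of the operator.
-/
theorem fracOp_fracOp_neg {d : ℕ} {κ : ℝ} (hκ : 0 < κ) (β : ℝ) (φ : 𝓢(E d, ℝ)) :
    fracOp κ β (fracOp κ (-β) φ) = φ := by
  have h : complexify (fracOp κ β (fracOp κ (-β) φ)) = complexify φ := by
    rw [complexify_fracOp hκ, complexify_fracOp hκ, fracOpComplex, fracOpComplex,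
      SchwartzMap.fourierMultiplierCLM_apply, SchwartzMap.fourierMultiplierCLM_apply,
      FourierInvPair.fourier_fourierInv_eq,
      SchwartzMap.smulLeftCLM_smulLeftCLM_apply (symbol_hasTemperateGrowth d hκ β)
        (symbol_hasTemperateGrowth d hκ (-β))]
    have : symbol d κ β * symbol d κ (-β) = fun _ => (1 : ℝ) := by
      ext ξ
      simp only [Pi.mul_apply, symbol]
      rw [← Real.rpow_add (by positivity)]
      simp [neg_div]
    rw [this]
    simp
  ext x
  exact Complex.ofReal_injective (DFunLike.congr_fun h x)

/-! ### The covariance in Fourier variables -/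

theorem continuous_exp_neg_I_mul {d : ℕ} (s : ℝ) :
    Continuous (fun p : E d × E d =>
      Complex.exp (-Complex.I * ((inner ℝ p.1 (s • p.2) : ℝ) : ℂ))) := by
  fun_prop

/-- Fubini, with `φ` integrable, the band compact and the exponential bounded. The scale `s` serves
only to choose the sign of the phase, `s = 1` or `s = -1`. -/
theorem integral_mul_setIntegral_exp {d : ℕ} (φ : 𝓢(E d, ℝ)) (κ s : ℝ) (g : E d → ℂ)
    (hg : Continuous g) :
    ∫ x, (φ x : ℂ) * ∫ ξ in band d κ,
        Complex.exp (-Complex.I * ((inner ℝ x (s • ξ) : ℝ) : ℂ)) * g ξ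
      = ∫ ξ in band d κ, ft φ (s • ξ) * g ξ := by
  have hgi : IntegrableOn g (band d κ) :=
    hg.continuousOn.integrableOn_compact (isCompact_closedBall _ _)
  have hi : Integrable (fun p : E d × E d => ((φ p.1 : ℂ) * g p.2) *
      Complex.exp (-Complex.I * ((inner ℝ p.1 (s • p.2) : ℝ) : ℂ)))
      (volume.prod (volume.restrict (band d κ))) := by
    refine (Integrable.mul_prod (f := fun x => (φ x : ℂ)) φ.integrable.ofReal hgi).mul_bdd (c := 1)
      (continuous_exp_neg_I_mul s).aestronglyMeasurable (ae_of_all _ fun p => ?_)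
    exact (norm_exp_neg_I_mul _).le
  calc _ = ∫ x, ∫ ξ in band d κ, ((φ x : ℂ) * g ξ) *
        Complex.exp (-Complex.I * ((inner ℝ x (s • ξ) : ℝ) : ℂ)) := by
        congr 1; ext x
        rw [← integral_const_mul]
        congr 1; ext ξ; ring
    _ = ∫ ξ in band d κ, ∫ x, ((φ x : ℂ) * g ξ) *
        Complex.exp (-Complex.I * ((inner ℝ x (s • ξ) : ℝ) : ℂ)) := integral_integral_swap hi
    _ = _ := by
        congr 1; ext ξ
        rw [ft, ← integral_mul_const]
        congr 1; ext x; ring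

theorem integral_covW {d : ℕ} (σ κ : ℝ) (φ ψ : 𝓢(E d, ℝ)) :
    ∫ x, ∫ y, ((φ x * ψ y : ℝ) : ℂ) * covW σ κ x y
      = ((σ ^ 2 / (2 * Real.pi) ^ d : ℝ) : ℂ) *
        ∫ ξ in band d κ, ft φ ξ * (starRingEnd ℂ) (ft ψ ξ) := by
  have h1 : ∀ x : E d, ∫ y, ((φ x * ψ y : ℝ) : ℂ) * covW σ κ x y
      = ((σ ^ 2 / (2 * Real.pi) ^ d : ℝ) : ℂ) * ((φ x : ℂ) * ∫ ξ in band d κ,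
        Complex.exp (-Complex.I * ((inner ℝ x ((1 : ℝ) • ξ) : ℝ) : ℂ)) *
          (starRingEnd ℂ) (ft ψ ξ)) := by
    intro x
    have h2 := integral_mul_setIntegral_exp ψ κ (-1)
      (fun ξ => Complex.exp (-Complex.I * ((inner ℝ x ξ : ℝ) : ℂ))) (by fun_prop)
    simp only [neg_smul, one_smul, ft_neg] at h2
    simp only [one_smul]
    rw [show (∫ ξ in band d κ, Complex.exp (-Complex.I * ((inner ℝ x ξ : ℝ) : ℂ)) *
          (starRingEnd ℂ) (ft ψ ξ)) = ∫ ξ in band d κ, (starRingEnd ℂ) (ft ψ ξ) *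
          Complex.exp (-Complex.I * ((inner ℝ x ξ : ℝ) : ℂ)) by simp_rw [mul_comm], ← h2,
      ← integral_const_mul, ← integral_const_mul]
    congr 1; ext y
    simp only [covW]
    have h3 : ∀ ξ : E d, Complex.exp (-Complex.I * ((inner ℝ (x - y) ξ : ℝ) : ℂ))
      = Complex.exp (-Complex.I * ((inner ℝ y (-ξ) : ℝ) : ℂ)) *
          Complex.exp (-Complex.I * ((inner ℝ x ξ : ℝ) : ℂ)) := by
      intro ξ
      rw [← Complex.exp_add, inner_sub_left, inner_neg_right]
      congr 1; push_cast; ring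
    simp_rw [h3]
    push_cast; ring
  simp_rw [h1]
  rw [integral_const_mul, integral_mul_setIntegral_exp φ κ 1 (fun ξ => (starRingEnd ℂ) (ft ψ ξ))
    (Complex.continuous_conj.comp (continuous_ft ψ))]
  simp

/-- There is a real test function whose Fourier transform is `1` on the band. -/
theorem exists_ft_eq_one (d : ℕ) (κ : ℝ) (hκ : 0 < κ) :
    ∃ η : 𝓢(E d, ℝ), ∀ ξ ∈ band d κ, ft η ξ = 1 := by
  let χ : ContDiffBump (0 : E d) := ⟨κ, κ + 1, hκ, by linarith⟩
  have hs : HasCompactSupport (fun ξ => (χ ((2 * Real.pi) • ξ) : ℂ)) :=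
    (χ.hasCompactSupport.comp_homeomorph
      (Homeomorph.smulOfNeZero (2 * Real.pi) (by positivity))).comp_left (g := Complex.ofReal) rfl
  have hc : ContDiff ℝ (⊤ : ℕ∞) (fun ξ => (χ ((2 * Real.pi) • ξ) : ℂ)) :=
    Complex.ofRealCLM.contDiff.comp (χ.contDiff.comp (contDiff_const_smul _))
  let g : 𝓢(E d, ℂ) := hs.toSchwartzMap hc
  -- The bump is real and even, so its inverse Fourier transform is real.
  have hreal : ∀ x, (starRingEnd ℂ) (𝓕⁻ g x) = 𝓕⁻ g x := by
    intro x
    rw [SchwartzMap.fourierInv_coe, Real.fourierInv_eq', ← integral_conj,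
      ← integral_neg_eq_self]
    congr 1
    ext ξ
    simp [← Complex.exp_conj, Complex.conj_ofNat, g, χ.neg]
  have hη : complexify (realPart (𝓕⁻ g)) = 𝓕⁻ g := by
    ext x
    exact Complex.conj_eq_iff_re.mp (hreal x)
  refine ⟨realPart (𝓕⁻ g), fun ξ hξ => ?_⟩
  rw [ft_eq_fourier, hη, FourierInvPair.fourier_fourierInv_eq]
  have : (2 * Real.pi) • (2 * Real.pi)⁻¹ • ξ = ξ := by
    rw [smul_smul, mul_inv_cancel₀ (by positivity), one_smul]
  change ((χ ((2 * Real.pi) • (2 * Real.pi)⁻¹ • ξ) : ℝ) : ℂ) = 1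
  rw [this, χ.one_of_mem_closedBall hξ, Complex.ofReal_one]

/-- The covariance form of truncated white noise in Fourier variables. -/
noncomputable def covForm {d : ℕ} (σ κ : ℝ) (φ ψ : 𝓢(E d, ℝ)) : ℂ :=
  ((σ ^ 2 / (2 * Real.pi) ^ d : ℝ) : ℂ) * ∫ ξ in band d κ, ft φ ξ * (starRingEnd ℂ) (ft ψ ξ)

theorem integrableOn_band {d : ℕ} (κ : ℝ) {g : E d → ℂ} (hg : Continuous g) :
    IntegrableOn g (band d κ) :=
  hg.continuousOn.integrableOn_compact (isCompact_closedBall _ _)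

theorem integrableOn_ft_mul_conj {d : ℕ} (κ : ℝ) (φ ψ : 𝓢(E d, ℝ)) :
    IntegrableOn (fun ξ => ft φ ξ * (starRingEnd ℂ) (ft ψ ξ)) (band d κ) :=
  integrableOn_band κ ((continuous_ft φ).mul (Complex.continuous_conj.comp (continuous_ft ψ)))

theorem covForm_add {d : ℕ} (σ κ : ℝ) (φ₁ φ₂ ψ : 𝓢(E d, ℝ)) :
    covForm σ κ (φ₁ + φ₂) ψ = covForm σ κ φ₁ ψ + covForm σ κ φ₂ ψ := by
  simp only [covForm, ft_add, add_mul]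
  rw [integral_add (integrableOn_ft_mul_conj κ _ _) (integrableOn_ft_mul_conj κ _ _), mul_add]

theorem covForm_smul {d : ℕ} (σ κ : ℝ) (a : ℝ) (φ ψ : 𝓢(E d, ℝ)) :
    covForm σ κ (a • φ) ψ = a * covForm σ κ φ ψ := by
  simp only [covForm, ft_smul, mul_assoc]
  rw [integral_const_mul]
  ring

theorem eq_of_forall_mem_inner_eq {H : Type*} [NormedAddCommGroup H] [InnerProductSpace ℝ H]
    (K : Submodule ℝ H) {a b : H} (ha : a ∈ K) (hb : b ∈ K)
    (h : ∀ v ∈ K, inner ℝ a v = (inner ℝ b v : ℝ)) : a = b := by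
  have h1 := h (a - b) (K.sub_mem ha hb)
  rw [← sub_eq_zero, ← inner_self_eq_zero (𝕜 := ℝ), inner_sub_left, h1, sub_self]

/-- Gaussianity supplies square integrability. Linearity is forced by the covariance: a vector in
the span of the `W φ` is determined by its inner products with them, and these are linear in `φ`. -/
theorem isTruncatedWhiteNoise_exists_linearMap {Ω : Type*} [MeasurableSpace Ω] {P : Measure Ω}
    {d : ℕ} {σ κ : ℝ} {W : 𝓢(E d, ℝ) → Ω → ℝ} (hW : IsTruncatedWhiteNoise σ κ W P) :
    ∃ U : 𝓢(E d, ℝ) →ₗ[ℝ] Lp ℝ 2 P, (∀ φ, U φ =ᵐ[P] W φ) ∧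
      ∀ φ ψ, ((inner ℝ (U φ) (U ψ) : ℝ) : ℂ) = covForm σ κ φ ψ := by
  have hL : ∀ φ, MemLp (W φ) 2 P := fun φ => (hW.gaussian.hasGaussianLaw_eval φ).memLp_two
  let u : 𝓢(E d, ℝ) → Lp ℝ 2 P := fun φ => (hL φ).toLp (W φ)
  have hu : ∀ φ, u φ =ᵐ[P] W φ := fun φ => (hL φ).coeFn_toLp
  have hin : ∀ φ ψ, ((inner ℝ (u φ) (u ψ) : ℝ) : ℂ) = covForm σ κ φ ψ := by
    intro φ ψ
    rw [covForm, ← integral_covW, ← hW.covariance, L2.inner_def]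
    congr 1
    refine integral_congr_ae ?_
    filter_upwards [hu φ, hu ψ] with ω h1 h2
    rw [h1, h2]
    simp [mul_comm]
  have key : ∀ a ∈ Submodule.span ℝ (Set.range u), ∀ b ∈ Submodule.span ℝ (Set.range u),
      (∀ χ, inner ℝ a (u χ) = (inner ℝ b (u χ) : ℝ)) → a = b := by
    intro a ha b hb h
    refine eq_of_forall_mem_inner_eq _ ha hb fun v hv => ?_
    induction hv using Submodule.span_induction with
    | mem v hv => obtain ⟨χ, rfl⟩ := hv; exact h χ
    | zero => simp
    | add x y _ _ hx hy => rw [inner_add_right, inner_add_right, hx, hy]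
    | smul c x _ hx => rw [inner_smul_right, inner_smul_right, hx]
  have hmem : ∀ φ, u φ ∈ Submodule.span ℝ (Set.range u) := fun φ =>
    Submodule.subset_span ⟨φ, rfl⟩
  refine ⟨{ toFun := u, map_add' := fun φ ψ => ?_, map_smul' := fun c φ => ?_ }, hu, hin⟩
  · refine key _ (hmem _) _ (add_mem (hmem _) (hmem _)) fun χ => Complex.ofReal_injective ?_
    rw [inner_add_left]
    push_cast
    rw [hin, hin, hin, covForm_add]
  · refine key _ (hmem _) _ (Submodule.smul_mem _ _ (hmem _)) fun χ => Complex.ofReal_injective ?_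
    simp only [RingHom.id_apply]
    rw [inner_smul_left]
    push_cast
    rw [hin, hin, covForm_smul]
    simp

/-- `U` is a linear Hilbert space model of truncated white noise. -/
def IsModel {H : Type*} [NormedAddCommGroup H] [InnerProductSpace ℝ H] {d : ℕ} (σ κ : ℝ)
    (U : 𝓢(E d, ℝ) →ₗ[ℝ] H) : Prop :=
  ∀ φ ψ, ((inner ℝ (U φ) (U ψ) : ℝ) : ℂ) = covForm σ κ φ ψ

/-! ### Hilbert space estimates for band-limited noise -/

section Model

variable {H : Type*} [NormedAddCommGroup H] [InnerProductSpace ℝ H] {d : ℕ} {σ κ : ℝ}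
  {U : 𝓢(E d, ℝ) →ₗ[ℝ] H}

/-- The total spectral mass of truncated white noise. -/
noncomputable def bandMass (d : ℕ) (σ κ : ℝ) : ℝ :=
  σ ^ 2 / (2 * Real.pi) ^ d * volume.real (band d κ)

/-- Reduces the norm estimates below to sup bounds for Fourier multipliers on the band. -/
theorem IsModel.norm_le (hU : IsModel σ κ U) (φ : 𝓢(E d, ℝ)) {ε : ℝ} (hε : 0 ≤ ε)
    (h : ∀ ξ ∈ band d κ, ‖ft φ ξ‖ ≤ ε) : ‖U φ‖ ≤ √(bandMass d σ κ) * ε := by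
  have hm : 0 ≤ σ ^ 2 / (2 * Real.pi) ^ d := by positivity
  have h1 : ‖U φ‖ ^ 2 ≤ bandMass d σ κ * ε ^ 2 := by
    have h2 : ‖((inner ℝ (U φ) (U φ) : ℝ) : ℂ)‖ = ‖U φ‖ ^ 2 := by
      rw [real_inner_self_eq_norm_sq, Complex.norm_real, Real.norm_of_nonneg (by positivity)]
    rw [← h2, hU, covForm, norm_mul, Complex.norm_real, Real.norm_of_nonneg hm, bandMass, mul_assoc]
    gcongr
    rw [mul_comm]
    refine norm_setIntegral_le_of_norm_le_const (by simp [band, measure_closedBall_lt_top])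
      fun ξ hξ => ?_
    rw [norm_mul, RCLike.norm_conj, ← sq]
    gcongr
    exact h ξ hξ
  have h3 : 0 ≤ bandMass d σ κ := by unfold bandMass; positivity
  rw [← Real.sqrt_sq hε, ← Real.sqrt_mul h3]
  exact Real.le_sqrt_of_sq_le h1

/-- The `n`-th order partial derivative in the coordinate directions `f 0, …, f (n-1)`. -/
noncomputable def partialDeriv (ψ : 𝓢(E d, ℝ)) {n : ℕ} (f : Fin n → Fin d) : 𝓢(E d, ℝ) :=
  ∂^{fun i => (EuclideanSpace.single (f i) (1 : ℝ) : E d)} ψ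

theorem ft_partialDeriv (ψ : 𝓢(E d, ℝ)) {n : ℕ} (f : Fin n → Fin d) (ξ : E d) :
    ft (partialDeriv ψ f) ξ = (∏ i, Complex.I * (ξ (f i) : ℂ)) * ft ψ ξ := by
  rw [partialDeriv, ft_iteratedLineDeriv]
  simp [EuclideanSpace.inner_single_left]

/-- A Bernstein inequality: each derivative is the multiplier `i ξ_j`, of size at most `κ` on the
band. -/
theorem IsModel.norm_partialDeriv_le (hU : IsModel σ κ U) (ψ : 𝓢(E d, ℝ)) (hκ : 0 < κ) {M : ℝ}
    (hM : 0 ≤ M) (hψ : ∀ ξ ∈ band d κ, ‖ft ψ ξ‖ ≤ M) {n : ℕ} (f : Fin n → Fin d) :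
    ‖U (partialDeriv ψ f)‖ ≤ √(bandMass d σ κ) * M * κ ^ n := by
  refine (hU.norm_le _ (ε := κ ^ n * M) (by positivity) fun ξ hξ => ?_).trans_eq (by ring)
  rw [ft_partialDeriv, norm_mul, norm_prod]
  gcongr
  · have : κ ^ n = ∏ i : Fin n, κ := by simp
    rw [this]
    gcongr with i
    rw [norm_mul, Complex.norm_I, one_mul, Complex.norm_real]
    exact (PiLp.norm_apply_le ξ (f i)).trans (by simpa [band] using hξ)
  · exact hψ ξ hξ

/-- The degree `n` term of the Taylor expansion of `a ↦ ψ (· - a)` at `0`. -/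
noncomputable def translateTerm (ψ : 𝓢(E d, ℝ)) (a : E d) (n : ℕ) : 𝓢(E d, ℝ) :=
  ((-1) ^ n / n.factorial : ℝ) • ∑ f : Fin n → Fin d, (∏ i, a (f i)) • partialDeriv ψ f

theorem ft_translateTerm (ψ : 𝓢(E d, ℝ)) (a : E d) (n : ℕ) (ξ : E d) :
    ft (translateTerm ψ a n) ξ
      = (-Complex.I * ((inner ℝ a ξ : ℝ) : ℂ)) ^ n / n.factorial * ft ψ ξ := by
  rw [translateTerm, ft_smul]
  have h1 : ft (∑ f : Fin n → Fin d, (∏ i, a (f i)) • partialDeriv ψ f) ξ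
      = (Complex.I * ((inner ℝ a ξ : ℝ) : ℂ)) ^ n * ft ψ ξ := by
    rw [← ftLM_apply, map_sum, Finset.sum_apply]
    simp only [ftLM_apply, ft_smul, ft_partialDeriv]
    have h2 : Complex.I * ((inner ℝ a ξ : ℝ) : ℂ) = ∑ j, (a j : ℂ) * (Complex.I * (ξ j : ℂ)) := by
      rw [PiLp.inner_apply, Complex.ofReal_sum, Finset.mul_sum]
      refine Finset.sum_congr rfl fun j _ => ?_
      simp
      ring
    rw [h2, Fintype.sum_pow, Finset.sum_mul]
    refine Finset.sum_congr rfl fun f _ => ?_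
    simp only [Finset.prod_mul_distrib]
    push_cast
    ring
  rw [h1, neg_mul, neg_pow]
  push_cast
  ring

theorem IsModel.tendsto_sum_translateTerm (hU : IsModel σ κ U) (ψ : 𝓢(E d, ℝ)) (hκ : 0 < κ) {M : ℝ}
    (hM : 0 ≤ M) (hψ : ∀ ξ ∈ band d κ, ‖ft ψ ξ‖ ≤ M) (a : E d) :
    Tendsto (fun N => ∑ n ∈ Finset.range N, U (translateTerm ψ a n)) atTop
      (𝓝 (U (ψ.compSubConstCLM ℝ a))) := by
  rw [tendsto_iff_norm_sub_tendsto_zero]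
  have h0 : Tendsto (fun N : ℕ => √(bandMass d σ κ) * ((‖a‖ * κ) ^ N / N.factorial * 2 * M)) atTop
      (𝓝 0) := by
    have := (((FloorSemiring.tendsto_pow_div_factorial_atTop (‖a‖ * κ)).mul_const 2).mul_const
      M).const_mul √(bandMass d σ κ)
    simpa using this
  refine squeeze_zero' (.of_forall fun _ => norm_nonneg _) ?_ h0
  -- Beyond twice the size of the exponent, the exponential remainder is at most twice its first
  -- omitted term.
  obtain ⟨N₀, hN₀⟩ := exists_nat_ge (2 * (‖a‖ * κ))
  filter_upwards [eventually_ge_atTop N₀] with N hN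
  rw [← map_sum, ← map_sub]
  refine hU.norm_le _ (by positivity) fun ξ hξ => ?_
  rw [← ftLM_apply, map_sub, map_sum, Pi.sub_apply, Finset.sum_apply]
  simp only [ftLM_apply, ft_translateTerm, ft_translate]
  rw [← Finset.sum_mul, ← sub_mul, norm_mul, norm_sub_rev]
  have hz : ‖-Complex.I * ((inner ℝ a ξ : ℝ) : ℂ)‖ ≤ ‖a‖ * κ := by
    rw [norm_mul, norm_neg, Complex.norm_I, one_mul, Complex.norm_real]
    refine (norm_inner_le_norm a ξ).trans ?_
    gcongr
    simpa [band] using hξ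
  gcongr
  · refine (Complex.exp_bound' ?_).trans ?_
    · rw [div_le_iff₀ (by positivity)]
      have : (N₀ : ℝ) ≤ N := by exact_mod_cast hN
      push_cast
      linarith
    · gcongr
  · exact hψ ξ hξ

/-- Yields the strong measurability in `a` needed for Bochner integrals of translates. -/
theorem IsModel.lipschitz_translate (hU : IsModel σ κ U) (ψ : 𝓢(E d, ℝ)) (hκ : 0 < κ) {M : ℝ}
    (hM : 0 ≤ M) (hψ : ∀ ξ ∈ band d κ, ‖ft ψ ξ‖ ≤ M) (a b : E d) :
    ‖U (ψ.compSubConstCLM ℝ a) - U (ψ.compSubConstCLM ℝ b)‖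
      ≤ √(bandMass d σ κ) * (κ * M) * ‖a - b‖ := by
  rw [← map_sub]
  refine (hU.norm_le _ (ε := ‖a - b‖ * κ * M) (by positivity) fun ξ hξ => ?_).trans_eq (by ring)
  rw [← ftLM_apply, map_sub, Pi.sub_apply, ftLM_apply, ftLM_apply, ft_translate, ft_translate,
    ← sub_mul, norm_mul]
  gcongr
  · have h1 : Complex.exp (-Complex.I * ((inner ℝ a ξ : ℝ) : ℂ))
        - Complex.exp (-Complex.I * ((inner ℝ b ξ : ℝ) : ℂ))
        = Complex.exp (-Complex.I * ((inner ℝ b ξ : ℝ) : ℂ)) *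
          (Complex.exp (Complex.I * ((inner ℝ (b - a) ξ : ℝ) : ℂ)) - 1) := by
      rw [mul_sub, ← Complex.exp_add, inner_sub_left]
      congr 2
      · push_cast; ring
      · simp
    rw [h1, norm_mul, norm_exp_neg_I_mul, one_mul, norm_sub_rev a b]
    refine Real.norm_exp_I_mul_ofReal_sub_one_le.trans ((norm_inner_le_norm _ _).trans ?_)
    gcongr
    simpa [band] using hξ
  · exact hψ ξ hξ

theorem IsModel.norm_translate_le (hU : IsModel σ κ U) (ψ : 𝓢(E d, ℝ)) {M : ℝ}
    (hM : 0 ≤ M) (hψ : ∀ ξ ∈ band d κ, ‖ft ψ ξ‖ ≤ M) (a : E d) :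
    ‖U (ψ.compSubConstCLM ℝ a)‖ ≤ √(bandMass d σ κ) * M := by
  refine hU.norm_le _ hM fun ξ hξ => ?_
  rw [ft_translate, norm_mul, norm_exp_neg_I_mul, one_mul]
  exact hψ ξ hξ

/-- Averaging the translates of `ψ` against `φ` yields the convolution `χ = φ * ψ`. -/
theorem IsModel.integral_translate [CompleteSpace H] (hU : IsModel σ κ U) (φ ψ χ : 𝓢(E d, ℝ))
    (hφ : Integrable (fun x => φ x • U (ψ.compSubConstCLM ℝ x)))
    (hχ : ∀ ξ ∈ band d κ, ft χ ξ = ft φ ξ * ft ψ ξ) :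
    ∫ x, φ x • U (ψ.compSubConstCLM ℝ x) = U χ := by
  have h1 : ∀ g, inner ℝ (U g) (∫ x, φ x • U (ψ.compSubConstCLM ℝ x))
      = (inner ℝ (U g) (U χ) : ℝ) := by
    intro g
    rw [← integral_inner hφ, real_inner_comm]
    apply Complex.ofReal_injective
    rw [hU, ← integral_complex_ofReal]
    simp only [inner_smul_right]
    have h2 : ∀ x, ((φ x * inner ℝ (U g) (U (ψ.compSubConstCLM ℝ x)) : ℝ) : ℂ)
        = ((σ ^ 2 / (2 * Real.pi) ^ d : ℝ) : ℂ) * ((φ x : ℂ) * ∫ ξ in band d κ,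
          Complex.exp (-Complex.I * ((inner ℝ x ((1 : ℝ) • ξ) : ℝ) : ℂ)) *
            (ft ψ ξ * (starRingEnd ℂ) (ft g ξ))) := by
      intro x
      rw [real_inner_comm]
      push_cast
      rw [hU, covForm]
      simp only [ft_translate, one_smul, mul_assoc]
      push_cast
      ring
    simp_rw [h2]
    rw [integral_const_mul, integral_mul_setIntegral_exp φ κ 1
      (fun ξ => ft ψ ξ * (starRingEnd ℂ) (ft g ξ))
      ((continuous_ft ψ).mul (Complex.continuous_conj.comp (continuous_ft g))), covForm]
    congr 1
    refine setIntegral_congr_fun measurableSet_closedBall fun ξ hξ => ?_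
    simp only [one_smul]
    rw [hχ ξ hξ, mul_assoc]
  set b := ∫ x, φ x • U (ψ.compSubConstCLM ℝ x) with hb
  have h2 : ∀ g, inner ℝ b (U g) = (inner ℝ (U χ) (U g) : ℝ) := fun g => by
    rw [real_inner_comm, h1, real_inner_comm]
  -- The integral `b` need not lie in the range of `U`, so `h2` cannot be tested on `b` directly;
  -- averaging `h2` over translates gives the missing pairing.
  have h3 : inner ℝ b b = (inner ℝ (U χ) b : ℝ) := by
    have h4 : ∀ c : H, inner ℝ c b = ∫ x, φ x * (inner ℝ c (U (ψ.compSubConstCLM ℝ x)) : ℝ) := by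
      intro c
      rw [hb, ← integral_inner hφ]
      simp only [inner_smul_right]
    rw [h4, h4]
    simp only [h2]
  rw [← sub_eq_zero, ← inner_self_eq_zero (𝕜 := ℝ), inner_sub_right, inner_sub_left, inner_sub_left,
    h3, h2]
  ring

end Model

/-! ### Everywhere convergent power series in several variables -/

section PowerSeries

variable {d : ℕ}

/-- The power series with coefficients `c n f` at the monomials `∏ i, x (f i)`. -/
noncomputable def coordSeries (c : ∀ n : ℕ, (Fin n → Fin d) → ℝ) :
    FormalMultilinearSeries ℝ (E d) ℝ := fun n =>
  ∑ f : Fin n → Fin d, c n f • (ContinuousMultilinearMap.mkPiAlgebra ℝ (Fin n)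
    ℝ).compContinuousLinearMap (fun i => (EuclideanSpace.proj (f i) : E d →L[ℝ] ℝ))

theorem coordSeries_apply (c : ∀ n : ℕ, (Fin n → Fin d) → ℝ) (n : ℕ) (x : Fin n → E d) :
    coordSeries c n x = ∑ f : Fin n → Fin d, c n f * ∏ i, x i (f i) := by
  simp [coordSeries]

theorem norm_coordSeries_le (c : ∀ n : ℕ, (Fin n → Fin d) → ℝ) (n : ℕ) :
    ‖coordSeries c n‖ ≤ ∑ f : Fin n → Fin d, |c n f| := by
  refine ContinuousMultilinearMap.opNorm_le_bound (by positivity) fun x => ?_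
  rw [coordSeries_apply, Finset.sum_mul]
  refine (norm_sum_le _ _).trans (Finset.sum_le_sum fun f _ => ?_)
  rw [norm_mul, norm_prod, Real.norm_eq_abs]
  gcongr with i
  exact PiLp.norm_apply_le (x i) (f i)

/-- Natural radii suffice, so random coefficients require only countably many null sets. -/
theorem coordSeries_radius {c : ∀ n : ℕ, (Fin n → Fin d) → ℝ}
    (hc : ∀ r : ℕ, Summable fun n => (∑ f : Fin n → Fin d, |c n f|) * (r : ℝ) ^ n) :
    (coordSeries c).radius = ⊤ := by
  refine FormalMultilinearSeries.radius_eq_top_of_summable_norm _ fun r => ?_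
  obtain ⟨R, hR⟩ := exists_nat_ge (r : ℝ)
  refine Summable.of_nonneg_of_le (fun n => by positivity) (fun n => ?_) (hc R)
  gcongr
  exact norm_coordSeries_le c n

theorem hasFPowerSeriesOnBall_coordSeries {c : ∀ n : ℕ, (Fin n → Fin d) → ℝ}
    (hc : ∀ r : ℕ, Summable fun n => (∑ f : Fin n → Fin d, |c n f|) * (r : ℝ) ^ n) :
    HasFPowerSeriesOnBall (coordSeries c).sum (coordSeries c) 0 ⊤ := by
  have := (coordSeries c).hasFPowerSeriesOnBall (by rw [coordSeries_radius hc]; simp)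
  rwa [coordSeries_radius hc] at this

theorem contDiff_coordSeries_sum {c : ∀ n : ℕ, (Fin n → Fin d) → ℝ}
    (hc : ∀ r : ℕ, Summable fun n => (∑ f : Fin n → Fin d, |c n f|) * (r : ℝ) ^ n) :
    ContDiff ℝ (⊤ : ℕ∞) (coordSeries c).sum := by
  refine AnalyticOnNhd.contDiff ?_
  have := (hasFPowerSeriesOnBall_coordSeries hc).analyticOnNhd
  rwa [Metric.eball_top] at this

theorem hasSum_coordSeries {c : ∀ n : ℕ, (Fin n → Fin d) → ℝ}
    (hc : ∀ r : ℕ, Summable fun n => (∑ f : Fin n → Fin d, |c n f|) * (r : ℝ) ^ n) (x : E d) :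
    HasSum (fun n => ∑ f : Fin n → Fin d, c n f * ∏ i, x (f i)) ((coordSeries c).sum x) := by
  have := (hasFPowerSeriesOnBall_coordSeries hc).hasSum (y := x) (by simp)
  simpa [coordSeries_apply] using this

end PowerSeries

/-! ### Sample paths and the pathwise representation -/

section Paths

variable {Ω : Type*} [MeasurableSpace Ω] {P : Measure Ω} {d : ℕ}

theorem lintegral_enorm_le_of_norm_le [IsProbabilityMeasure P] (f : Lp ℝ 2 P) {K : ℝ}
    (h : ‖f‖ ≤ K) : ∫⁻ ω, ‖f ω‖ₑ ∂P ≤ ENNReal.ofReal K := by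
  rw [← eLpNorm_one_eq_lintegral_enorm]
  refine (eLpNorm_le_eLpNorm_of_exponent_le (q := 2) (by norm_num)
    (Lp.aestronglyMeasurable f)).trans ?_
  rw [← Lp.enorm_def, ← ofReal_norm]
  exact ENNReal.ofReal_le_ofReal h

/-- The expected sum is finite: `d ^ n` index tuples, each of mean size at most `K κ ^ n`, give the
bound `K ∑ (r d κ) ^ n / n!`. -/
theorem ae_summable_of_norm_le [IsProbabilityMeasure P] (D : ∀ n : ℕ, (Fin n → Fin d) → Lp ℝ 2 P)
    {K κ : ℝ} (hκ : 0 ≤ κ) (hK : 0 ≤ K) (hD : ∀ n f, ‖D n f‖ ≤ K * κ ^ n) (r : ℕ) :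
    ∀ᵐ ω ∂P, Summable fun n : ℕ =>
      (∑ f : Fin n → Fin d, |(-1) ^ n / n.factorial * D n f ω|) * (r : ℝ) ^ n := by
  have hm : ∀ n f, Measurable (D n f) := fun n f => (Lp.stronglyMeasurable (D n f)).measurable
  have hfin : ∫⁻ ω, ∑' n : ℕ, ENNReal.ofReal ((r : ℝ) ^ n / n.factorial) *
      ∑ f : Fin n → Fin d, ‖D n f ω‖ₑ ∂P ≠ ⊤ := by
    rw [lintegral_tsum fun n => by fun_prop]
    have hle : ∀ n : ℕ, ∫⁻ ω, ENNReal.ofReal ((r : ℝ) ^ n / n.factorial) *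
        ∑ f : Fin n → Fin d, ‖D n f ω‖ₑ ∂P
        ≤ ENNReal.ofReal (K * ((r * d * κ) ^ n / n.factorial)) := by
      intro n
      rw [lintegral_const_mul _ (by fun_prop), lintegral_finsetSum _ (fun f _ => by fun_prop)]
      calc _ ≤ ENNReal.ofReal ((r : ℝ) ^ n / n.factorial) *
            ∑ f : Fin n → Fin d, ENNReal.ofReal (K * κ ^ n) := by
            gcongr with f
            exact lintegral_enorm_le_of_norm_le _ (hD n f)
        _ = ENNReal.ofReal (K * ((r * d * κ) ^ n / n.factorial)) := by
            rw [Finset.sum_const, Finset.card_univ, Fintype.card_fun, Fintype.card_fin,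
              Fintype.card_fin, nsmul_eq_mul, ← ENNReal.ofReal_natCast,
              ← ENNReal.ofReal_mul (by positivity), ← ENNReal.ofReal_mul (by positivity)]
            congr 1
            push_cast
            rw [mul_pow, mul_pow]
            ring
    refine ne_top_of_le_ne_top ?_ (ENNReal.tsum_le_tsum hle)
    exact ((Real.summable_pow_div_factorial (r * d * κ)).mul_left K).tsum_ofReal_ne_top
  filter_upwards [ae_lt_top (by fun_prop) hfin] with ω hω
  have := ENNReal.summable_toReal hω.ne
  refine this.congr fun n => ?_
  rw [ENNReal.toReal_mul, ENNReal.toReal_ofReal (by positivity),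
    ENNReal.toReal_sum (fun f _ => enorm_ne_top), Finset.mul_sum, Finset.sum_mul]
  refine Finset.sum_congr rfl fun f _ => ?_
  rw [abs_mul, abs_div, abs_pow, abs_neg, abs_one, one_pow, toReal_enorm, Real.norm_eq_abs,
    Nat.abs_cast]
  ring

theorem IsModel.exists_smooth_field [IsProbabilityMeasure P] {σ κ : ℝ}
    {U : 𝓢(E d, ℝ) →ₗ[ℝ] Lp ℝ 2 P} (hU : IsModel σ κ U) (ψ : 𝓢(E d, ℝ)) (hκ : 0 < κ) {M : ℝ}
    (hM : 0 ≤ M) (hψ : ∀ ξ ∈ band d κ, ‖ft ψ ξ‖ ≤ M) :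
    ∃ Y : E d → Ω → ℝ, (∀ x, Measurable (Y x)) ∧
      (∀ ω, ContDiff ℝ (⊤ : ℕ∞) (fun x => Y x ω)) ∧
      ∀ x, Y x =ᵐ[P] U (ψ.compSubConstCLM ℝ x) := by
  let D : ∀ n : ℕ, (Fin n → Fin d) → Lp ℝ 2 P := fun n f => U (partialDeriv ψ f)
  let c : Ω → ∀ n : ℕ, (Fin n → Fin d) → ℝ := fun ω n f => (-1) ^ n / n.factorial * D n f ω
  have hcm : ∀ n f, Measurable fun ω => c ω n f := fun n f =>
    (Lp.stronglyMeasurable (D n f)).measurable.const_mul _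
  have hae : ∀ᵐ ω ∂P, ∀ r : ℕ,
      Summable fun n => (∑ f : Fin n → Fin d, |c ω n f|) * (r : ℝ) ^ n :=
    ae_all_iff.2 fun r => ae_summable_of_norm_le D hκ.le (K := √(bandMass d σ κ) * M)
      (by positivity) (fun n f => hU.norm_partialDeriv_le ψ hκ hM hψ f) r
  -- Setting the field to zero on a measurable null set keeps it measurable and makes every path
  -- smooth.
  obtain ⟨B, hB, hBm, hB0⟩ := exists_measurable_superset_of_null (ae_iff.1 hae)
  have hG : ∀ ω ∈ Bᶜ, ∀ r : ℕ,
      Summable fun n => (∑ f : Fin n → Fin d, |c ω n f|) * (r : ℝ) ^ n := fun ω hω => by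
    by_contra h
    exact hω (hB h)
  have hBae : ∀ᵐ ω ∂P, ω ∈ Bᶜ := measure_eq_zero_iff_ae_notMem.1 hB0
  refine ⟨fun x => Bᶜ.indicator fun ω => ∑' n, ∑ f : Fin n → Fin d, c ω n f * ∏ i, x (f i),
    fun x => ?_, fun ω => ?_, fun x => ?_⟩
  · exact (Measurable.tsum fun n => by fun_prop).indicator hBm.compl
  · by_cases hω : ω ∈ Bᶜ
    · convert contDiff_coordSeries_sum (hG ω hω) using 2 with x
      exact (Set.indicator_of_mem hω _).trans (hasSum_coordSeries (hG ω hω) x).tsum_eq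
    · simp only [Set.indicator_of_notMem hω]
      exact contDiff_const
  · have hterm : ∀ n, U (translateTerm ψ x n)
        =ᵐ[P] fun ω => ∑ f : Fin n → Fin d, c ω n f * ∏ i, x (f i) := by
      intro n
      have h1 : U (translateTerm ψ x n) = ((-1) ^ n / n.factorial : ℝ) •
          ∑ f : Fin n → Fin d, (∏ i, x (f i)) • D n f := by
        simp [translateTerm, D]
      rw [h1]
      have h2 : ∀ᵐ ω ∂P, ∀ f : Fin n → Fin d,
          ((∏ i, x (f i)) • D n f : Lp ℝ 2 P) ω = (∏ i, x (f i)) * D n f ω :=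
        ae_all_iff.2 fun f => Lp.coeFn_smul _ _
      filter_upwards [Lp.coeFn_smul ((-1) ^ n / n.factorial : ℝ)
        (∑ f : Fin n → Fin d, (∏ i, x (f i)) • D n f),
        Lp.coeFn_finsetSum (Finset.univ : Finset (Fin n → Fin d)) fun f => (∏ i, x (f i)) • D n f,
        h2] with ω h3 h4 h5
      rw [h3, Pi.smul_apply, h4, Finset.sum_apply, smul_eq_mul, Finset.mul_sum]
      refine Finset.sum_congr rfl fun f _ => ?_
      rw [h5]
      ring
    have hsum : ∀ N : ℕ, (∑ n ∈ Finset.range N, U (translateTerm ψ x n) : Lp ℝ 2 P)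
        =ᵐ[P] fun ω => ∑ n ∈ Finset.range N, ∑ f : Fin n → Fin d, c ω n f * ∏ i, x (f i) := by
      intro N
      filter_upwards [Lp.coeFn_finsetSum (Finset.range N) fun n => U (translateTerm ψ x n),
        ae_all_iff.2 hterm] with ω h1 h2
      rw [h1, Finset.sum_apply]
      exact Finset.sum_congr rfl fun n _ => h2 n
    -- The Taylor sums converge in `L²` to the translate and almost surely to the series; limits in
    -- measure are unique.
    have hL := tendstoInMeasure_of_tendsto_Lp (hU.tendsto_sum_translateTerm ψ hκ hM hψ x)
    refine tendstoInMeasure_ae_unique (tendstoInMeasure_of_tendsto_ae (fun N => ?_) ?_)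
      (hL.congr hsum .rfl)
    · exact Measurable.aestronglyMeasurable (by fun_prop)
    · filter_upwards [hBae] with ω hω
      rw [Set.indicator_of_mem hω, (hasSum_coordSeries (hG ω hω) x).tsum_eq]
      exact (hasSum_coordSeries (hG ω hω) x).tendsto_sum_nat

/-- An integrable weight of polynomial decay. -/
noncomputable def weight (d : ℕ) (x : E d) : ℝ := ((1 + ‖x‖) ^ (d + 1))⁻¹

theorem continuous_weight (d : ℕ) : Continuous (weight d) :=
  Continuous.inv₀ (by fun_prop) fun x => by positivity

theorem integrable_weight (d : ℕ) : Integrable (weight d) := by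
  have := integrable_one_add_norm (E := E d) (μ := volume) (r := d + 1) (by simp)
  convert this using 2 with x
  rw [weight, Real.rpow_neg (by positivity)]
  norm_cast

/-- Integration against a function of polynomial growth is a tempered distribution. -/
theorem exists_clm_eq_integral_mul (y : E d → ℝ) (hy : Integrable fun x => weight d x * y x) :
    ∃ L : 𝓢(E d, ℝ) →L[ℝ] ℝ, ∀ φ : 𝓢(E d, ℝ),
      Integrable (fun x => φ x * y x) ∧ L φ = ∫ x, φ x * y x := by
  let p : Seminorm ℝ 𝓢(E d, ℝ) :=
    (Finset.Iic (d + 1, 0)).sup (schwartzSeminormFamily ℝ (E d) ℝ)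
  have hb : ∀ (φ : 𝓢(E d, ℝ)) x, ‖(1 + ‖x‖) ^ (d + 1) * φ x‖ ≤ 2 ^ (d + 1) * p φ := by
    intro φ x
    have := SchwartzMap.one_add_le_sup_seminorm_apply (𝕜 := ℝ) (m := (d + 1, 0)) (k := d + 1)
      (n := 0) le_rfl le_rfl φ x
    rw [norm_iteratedFDeriv_zero] at this
    rw [norm_mul, Real.norm_of_nonneg (by positivity)]
    exact this
  have heq : ∀ (φ : 𝓢(E d, ℝ)) x,
      φ x * y x = ((1 + ‖x‖) ^ (d + 1) * φ x) * (weight d x * y x) := by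
    intro φ x
    have : (1 + ‖x‖) ^ (d + 1) ≠ 0 := by positivity
    rw [weight]
    field_simp
  have hi : ∀ φ : 𝓢(E d, ℝ), Integrable fun x => φ x * y x := by
    intro φ
    simp_rw [heq]
    refine hy.bdd_mul (c := 2 ^ (d + 1) * p φ) ?_ (ae_of_all _ (hb φ))
    exact Continuous.aestronglyMeasurable (by fun_prop)
  refine ⟨SchwartzMap.mkCLMtoNormedSpace (fun φ => ∫ x, φ x * y x) (fun φ ψ => ?_) (fun a φ => ?_)
    ⟨Finset.Iic (d + 1, 0), 2 ^ (d + 1) * ∫ x, ‖weight d x * y x‖, by positivity, fun φ => ?_⟩,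
    fun φ => ⟨hi φ, rfl⟩⟩
  · rw [← integral_add (hi φ) (hi ψ)]
    simp [add_mul]
  · simp only [smul_apply, smul_eq_mul, mul_assoc, RingHom.id_apply]
    rw [integral_const_mul]
  · calc ‖∫ x, φ x * y x‖ ≤ ∫ x, 2 ^ (d + 1) * p φ * ‖weight d x * y x‖ := by
          refine norm_integral_le_of_norm_le (hy.norm.const_mul _) (ae_of_all _ fun x => ?_)
          rw [heq, norm_mul]
          gcongr
          exact hb φ x
      _ = _ := by rw [integral_const_mul]; ring

/-- Rests on `E|Y x| ≤ K` uniformly in `x`; applied both to the weight and to test functions. -/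
theorem integrable_prod_mul [IsProbabilityMeasure P] {Y : E d → Ω → ℝ}
    (hY : Measurable (Function.uncurry Y)) {K : ℝ} {V : E d → Lp ℝ 2 P} (hYV : ∀ x, Y x =ᵐ[P] V x)
    (hV : ∀ x, ‖V x‖ ≤ K) {h : E d → ℝ} (hh : Integrable h) (hhm : Measurable h) :
    Integrable (fun p : E d × Ω => h p.1 * Y p.1 p.2) (volume.prod P) := by
  have hm : Measurable (fun p : E d × Ω => h p.1 * Y p.1 p.2) :=
    (hhm.comp measurable_fst).mul hY
  have hYi : ∀ x, Integrable (Y x) P := fun x =>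
    ((Lp.memLp (V x)).integrable (by norm_num)).congr (hYV x).symm
  rw [integrable_prod_iff hm.aestronglyMeasurable]
  refine ⟨ae_of_all _ fun x => (hYi x).const_mul (h x), ?_⟩
  refine (hh.norm.mul_const K).mono' hm.aestronglyMeasurable.norm.integral_prod_right'
    (ae_of_all _ fun x => ?_)
  rw [Real.norm_of_nonneg (integral_nonneg fun _ => norm_nonneg _)]
  simp only [norm_mul]
  rw [integral_const_mul]
  gcongr
  have hK : 0 ≤ K := (norm_nonneg _).trans (hV x)
  rw [integral_norm_eq_lintegral_enorm (hYi x).aestronglyMeasurable]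
  refine ENNReal.toReal_le_of_le_ofReal hK ?_
  refine (lintegral_congr_ae ((hYV x).fun_comp (‖·‖ₑ))).trans_le ?_
  exact lintegral_enorm_le_of_norm_le _ (hV x)

/-- Both sides have the same integral over each event, by Fubini, so the `L²`-valued integral can be
computed pathwise. -/
theorem ae_eq_integral_mul [IsProbabilityMeasure P] {Y : E d → Ω → ℝ} {V : E d → Lp ℝ 2 P}
    (hYV : ∀ x, Y x =ᵐ[P] V x) {h : E d → ℝ} (hV : Integrable fun x => h x • V x)
    (hi : Integrable (fun p : E d × Ω => h p.1 * Y p.1 p.2) (volume.prod P)) :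
    (∫ x, h x • V x : Lp ℝ 2 P) =ᵐ[P] fun ω => ∫ x, h x * Y x ω := by
  refine Integrable.ae_eq_of_forall_setIntegral_eq _ _ ((Lp.memLp _).integrable (by norm_num))
    hi.integral_prod_right fun s hs _ => ?_
  rw [← L2.inner_indicatorConstLp_one hs (measure_ne_top P s), ← integral_inner hV]
  have hi' : Integrable (fun p : E d × Ω => h p.1 * Y p.1 p.2)
      (volume.prod (P.restrict s)) := by
    rw [← Measure.restrict_univ (μ := (volume : Measure (E d))), Measure.prod_restrict]
    exact hi.integrableOn
  rw [← integral_integral_swap (f := fun x ω => h x * Y x ω) hi']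
  congr 1
  ext x
  rw [inner_smul_right, L2.inner_indicatorConstLp_one hs (measure_ne_top P s), integral_const_mul]
  congr 1
  exact integral_congr_ae (ae_restrict_of_ae (hYV x).symm)

theorem exists_smooth_representation [IsProbabilityMeasure P] {σ κ α : ℝ} (hκ : 0 < κ)
    {W X : 𝓢(E d, ℝ) → Ω → ℝ} (hW : IsTruncatedWhiteNoise σ κ W P)
    (hX : IsWeakSolution κ α X W P) :
    ∃ Y : E d → Ω → ℝ, (∀ x, Measurable (Y x)) ∧
      (∀ ω, ContDiff ℝ (⊤ : ℕ∞) (fun x => Y x ω)) ∧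
      (∀ᵐ ω ∂P, Integrable fun x => weight d x * Y x ω) ∧
      (∀ φ : 𝓢(E d, ℝ), ∀ᵐ ω ∂P, X φ ω = ∫ x, φ x * Y x ω) := by
  obtain ⟨U, hUW, hU⟩ := isTruncatedWhiteNoise_exists_linearMap hW
  have hU : IsModel σ κ U := hU
  obtain ⟨η, hη⟩ := exists_ft_eq_one d κ hκ
  let ψ := fracOp κ (-α) η
  obtain ⟨M, hM⟩ := (isCompact_closedBall (0 : E d) κ).exists_bound_of_continuousOn
    (continuous_ft ψ).continuousOn
  have hM0 : 0 ≤ M := (norm_nonneg _).trans (hM 0 (by simp [hκ.le]))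
  obtain ⟨Y, hYm, hYc, hYU⟩ := hU.exists_smooth_field ψ hκ hM0 hM
  have hY : Measurable (Function.uncurry Y) :=
    measurable_uncurry_of_continuous_of_measurable (fun ω => (hYc ω).continuous) hYm
  have hV : ∀ x, ‖U (ψ.compSubConstCLM ℝ x)‖ ≤ √(bandMass d σ κ) * M :=
    hU.norm_translate_le ψ hM0 hM
  have hVc : Continuous fun x => U (ψ.compSubConstCLM ℝ x) := by
    refine (LipschitzWith.of_dist_le_mul
      (K := Real.toNNReal (√(bandMass d σ κ) * (κ * M))) fun a b => ?_).continuous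
    rw [dist_eq_norm, dist_eq_norm, Real.coe_toNNReal _ (by positivity)]
    exact hU.lipschitz_translate ψ hκ hM0 hM a b
  refine ⟨Y, hYm, hYc, ?_, fun φ => ?_⟩
  -- One fixed weight dominates all test functions, so the null set does not depend on `φ`.
  · exact (integrable_prod_mul hY hYU hV (integrable_weight d)
      (continuous_weight d).measurable).prod_left_ae
  · have hφV : Integrable fun x => φ x • U (ψ.compSubConstCLM ℝ x) :=
      φ.integrable.smul_bdd _ hVc.aestronglyMeasurable (ae_of_all _ hV)
    have h1 := ae_eq_integral_mul hYU hφV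
      (integrable_prod_mul hY hYU hV φ.integrable φ.continuous.measurable)
    rw [hU.integral_translate φ ψ (fracOp κ (-α) φ) hφV fun ξ hξ => by
      rw [ft_fracOp hκ, ft_fracOp hκ, hη ξ hξ]; ring] at h1
    have h2 := hX (fracOp κ (-α) φ)
    rw [fracOp_fracOp_neg hκ] at h2
    filter_upwards [h1, h2, hUW (fracOp κ (-α) φ)] with ω h3 h4 h5
    rw [h4, ← h5, h3]

end Paths

/-! ### Separability of the Schwartz space and the simultaneous identity -/

theorem secondCountableTopology_onePoint (d : ℕ) : SecondCountableTopology (OnePoint (E d)) :=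
  (onePointEquivSphereOfFinrankEq (ι := Fin (d + 1)) (V := E d) (by simp)).secondCountableTopology

theorem secondCountableTopology_continuousMultilinearMap (d n : ℕ) :
    SecondCountableTopology (ContinuousMultilinearMap ℝ (fun _ : Fin n => E d) ℝ) := by
  have : FiniteDimensional ℝ (ContinuousMultilinearMap ℝ (fun _ : Fin n => E d) ℝ) :=
    FiniteDimensional.of_injective
      (ContinuousMultilinearMap.toMultilinearMapLinear  :
        ContinuousMultilinearMap ℝ (fun _ : Fin n => E d) ℝ →ₗ[ℝ] _)
      ContinuousMultilinearMap.toMultilinearMap_injective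
  have := FiniteDimensional.proper ℝ (ContinuousMultilinearMap ℝ (fun _ : Fin n => E d) ℝ)
  exact secondCountable_of_proper

theorem tendsto_norm_pow_smul_iteratedFDeriv {d : ℕ} (k n : ℕ) (φ : 𝓢(E d, ℝ)) :
    Tendsto (fun x => ‖x‖ ^ k • iteratedFDeriv ℝ n φ x) (coclosedCompact (E d)) (𝓝 0) := by
  rw [coclosedCompact_eq_cocompact, tendsto_zero_iff_norm_tendsto_zero]
  have h0 : Tendsto (fun x : E d => SchwartzMap.seminorm ℝ (k + 1) n φ * ‖x‖⁻¹) (cocompact (E d))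
      (𝓝 0) := by
    simpa using (tendsto_inv_atTop_zero.comp
      (tendsto_norm_cocompact_atTop (E := E d))).const_mul (SchwartzMap.seminorm ℝ (k + 1) n φ)
  refine squeeze_zero' (.of_forall fun _ => norm_nonneg _) ?_ h0
  filter_upwards [(tendsto_norm_cocompact_atTop (E := E d)).eventually_gt_atTop 0] with x hx
  rw [← div_eq_mul_inv, le_div_iff₀ hx, norm_smul, norm_pow, norm_norm]
  refine le_trans (le_of_eq ?_) (SchwartzMap.le_seminorm ℝ (k + 1) n φ x)
  ring

/-- The weighted jet `‖x‖ ^ k • D ^ n φ` as a continuous function on the compactification. -/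
noncomputable def weightedJet {d : ℕ} (i : ℕ × ℕ) (φ : 𝓢(E d, ℝ)) :
    C(OnePoint (E d), ContinuousMultilinearMap ℝ (fun _ : Fin i.2 => E d) ℝ) :=
  OnePoint.continuousMapMk ⟨fun x => ‖x‖ ^ i.1 • iteratedFDeriv ℝ i.2 φ x,
    (continuous_norm.pow _).smul ((φ.smooth ⊤).continuous_iteratedFDeriv (by exact_mod_cast le_top))⟩
    0 (tendsto_norm_pow_smul_iteratedFDeriv i.1 i.2 φ)

theorem weightedJet_coe {d : ℕ} (i : ℕ × ℕ) (φ : 𝓢(E d, ℝ)) (x : E d) :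
    weightedJet i φ (x : OnePoint (E d)) = ‖x‖ ^ i.1 • iteratedFDeriv ℝ i.2 φ x := rfl

theorem weightedJet_infty {d : ℕ} (i : ℕ × ℕ) (φ : 𝓢(E d, ℝ)) :
    weightedJet i φ OnePoint.infty = 0 := rfl

theorem weightedJet_add {d : ℕ} (i : ℕ × ℕ) (φ ψ : 𝓢(E d, ℝ)) :
    weightedJet i (φ + ψ) = weightedJet i φ + weightedJet i ψ := by
  ext1 x
  rw [ContinuousMap.add_apply]
  induction x with
  | infty => simp only [weightedJet_infty, add_zero]
  | coe x =>
    have h : iteratedFDeriv ℝ i.2 (φ + ψ : 𝓢(E d, ℝ)) x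
        = iteratedFDeriv ℝ i.2 φ x + iteratedFDeriv ℝ i.2 ψ x :=
      iteratedFDeriv_add_apply (φ.smooth i.2).contDiffAt (ψ.smooth i.2).contDiffAt
    rw [weightedJet_coe, weightedJet_coe, weightedJet_coe, h, smul_add]

/-- Realises each Schwartz seminorm as a sup norm on a compact space, so that the weighted jets
together induce the Schwartz topology. -/
theorem norm_weightedJet {d : ℕ} (i : ℕ × ℕ) (φ : 𝓢(E d, ℝ)) :
    ‖weightedJet i φ‖ = schwartzSeminormFamily ℝ (E d) ℝ i φ := by
  have hx : ∀ x : E d, ‖weightedJet i φ (x : OnePoint (E d))‖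
      = ‖x‖ ^ i.1 * ‖iteratedFDeriv ℝ i.2 φ x‖ := fun x => by
    rw [weightedJet_coe, norm_smul, norm_pow, norm_norm]
  refine le_antisymm ?_ ?_
  · rw [ContinuousMap.norm_le _ (apply_nonneg _ _)]
    intro x
    induction x with
    | infty => rw [weightedJet_infty, norm_zero]; exact apply_nonneg _ _
    | coe x => exact (hx x).trans_le (SchwartzMap.le_seminorm ℝ i.1 i.2 φ x)
  · refine SchwartzMap.seminorm_le_bound ℝ i.1 i.2 φ
      ((norm_nonneg _).trans ((weightedJet i φ).norm_coe_le_norm OnePoint.infty)) fun x => ?_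
    exact (hx x).symm.trans_le ((weightedJet i φ).norm_coe_le_norm (x : OnePoint (E d)))

/-- The space of real test functions is second countable. -/
theorem secondCountableTopology_schwartzMap (d : ℕ) : SecondCountableTopology 𝓢(E d, ℝ) := by
  have := secondCountableTopology_onePoint d
  have := secondCountableTopology_continuousMultilinearMap d
  let J : 𝓢(E d, ℝ) →+ (∀ i : ℕ × ℕ,
      C(OnePoint (E d), ContinuousMultilinearMap ℝ (fun _ : Fin i.2 => E d) ℝ)) :=
    AddMonoidHom.mk' (fun φ i => weightedJet i φ) fun φ ψ => funext fun i => weightedJet_add i φ ψ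
  -- The target is a countable product of second countable spaces, and an inducing map pulls second
  -- countability back.
  have hJ : IsInducing J := by
    rw [IsTopologicalAddGroup.isInducing_iff_nhds_zero,
      (SeminormFamily.withSeminorms_iff_nhds_eq_iInf _).1 (schwartz_withSeminorms ℝ (E d) ℝ),
      nhds_pi, Filter.pi, comap_iInf]
    refine iInf_congr fun i => ?_
    rw [comap_comap, Pi.zero_apply, ← comap_norm_nhds_zero (E := C(OnePoint (E d),
      ContinuousMultilinearMap ℝ (fun _ : Fin i.2 => E d) ℝ)), comap_comap]
    exact congrArg (fun f : 𝓢(E d, ℝ) → ℝ => comap f (𝓝 0))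
      (funext fun φ => (norm_weightedJet i φ).symm)
  exact hJ.secondCountableTopology


/-- Off one null set, two continuous functionals agree on a countable dense set of test functions,
hence everywhere. -/
theorem ae_forall_eq_integral_mul {Ω : Type*} [MeasurableSpace Ω] {P : Measure Ω} {d : ℕ}
    {X : 𝓢(E d, ℝ) → Ω → ℝ} {Y : E d → Ω → ℝ}
    (hY : ∀ᵐ ω ∂P, Integrable fun x => weight d x * Y x ω)
    (hXY : ∀ φ : 𝓢(E d, ℝ), ∀ᵐ ω ∂P, X φ ω = ∫ x, φ x * Y x ω)
    (hX : ∀ᵐ ω ∂P, ∃ T : 𝓢(E d, ℝ) →L[ℝ] ℝ, ∀ φ, X φ ω = T φ) :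
    ∀ᵐ ω ∂P, ∀ φ : 𝓢(E d, ℝ), X φ ω = ∫ x, φ x * Y x ω := by
  have := secondCountableTopology_schwartzMap d
  have hdense : ∀ᵐ ω ∂P, ∀ k : ℕ, X (TopologicalSpace.denseSeq 𝓢(E d, ℝ) k) ω
      = ∫ x, TopologicalSpace.denseSeq 𝓢(E d, ℝ) k x * Y x ω := ae_all_iff.2 fun k => hXY _
  filter_upwards [hY, hX, hdense] with ω hYω hXω h φ
  obtain ⟨T, hT⟩ := hXω
  obtain ⟨L, hL⟩ := exists_clm_eq_integral_mul _ hYω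
  have hTL : (T : 𝓢(E d, ℝ) → ℝ) = L := by
    refine (TopologicalSpace.denseRange_denseSeq 𝓢(E d, ℝ)).equalizer T.continuous L.continuous ?_
    ext1 k
    exact (hT _).symm.trans ((h k).trans (hL _).2.symm)
  rw [hT, hTL, (hL φ).2]

end BandLimitedMatern

theorem mainTheorem5 {Ω : Type*} [MeasurableSpace Ω] (P : Measure Ω) [IsProbabilityMeasure P]
    (d : ℕ) (σ κ α : ℝ) (hσ : 0 < σ) (hκ : 0 < κ)
    (W X : 𝓢(BandLimitedMatern.E d, ℝ) → Ω → ℝ)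
    (hW : BandLimitedMatern.IsTruncatedWhiteNoise σ κ W P)
    (hX : BandLimitedMatern.IsWeakSolution κ α X W P) :
    ∃ Y : BandLimitedMatern.E d → Ω → ℝ,
      (∀ x, Measurable (Y x)) ∧
      (∀ᵐ ω ∂P, ContDiff ℝ (⊤ : ℕ∞) (fun x => Y x ω)) ∧
      (∀ᵐ ω ∂P, ∀ φ : 𝓢(BandLimitedMatern.E d, ℝ), Integrable (fun x => φ x * Y x ω)) ∧
      (∀ φ : 𝓢(BandLimitedMatern.E d, ℝ), ∀ᵐ ω ∂P, X φ ω = ∫ x, φ x * Y x ω) ∧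
      ((∀ᵐ ω ∂P, ∃ T : 𝓢(BandLimitedMatern.E d, ℝ) →L[ℝ] ℝ, ∀ φ, X φ ω = T φ) →
        ∀ᵐ ω ∂P, ∀ φ : 𝓢(BandLimitedMatern.E d, ℝ), X φ ω = ∫ x, φ x * Y x ω) := by
  obtain ⟨Y, hYm, hYc, hYw, hXY⟩ :=
    BandLimitedMatern.exists_smooth_representation hκ hW hX
  refine ⟨Y, hYm, Filter.Eventually.of_forall hYc, ?_, hXY, fun hT =>
    BandLimitedMatern.ae_forall_eq_integral_mul hYw hXY hT⟩
  filter_upwards [hYw] with ω hω φ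
  obtain ⟨L, hL⟩ := BandLimitedMatern.exists_clm_eq_integral_mul _ hω
  exact (hL φ).1
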